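/- Let $n\ge 1$ and let $q_{ij}\ge 0$ ($1\le i,j\le n$, $i\ne j$) be arbitrary non-negative real numbers, $q_{ij}$ being the rate constant of the transition $A_j\to A_i$. Let $K=(k_{ij})$ be the real $n\times n$ matrix of the master equation $\dot p_i=\sum_{j\ne i}(q_{ij}p_j-q_{ji}p_i)$, that is, $k_{ij}=q_{ij}$ for $i\ne j$ and $k_{ii}=-\sum_{m\ne i}q_{mi}$. Then every nonzero complex eigenvalue $\lambda$ of $K$ satisfies $\operatorname{Re}\lambda\neq 0$ and $$\frac{|\operatorname{Im}\lambda|}{|\operatorname{Re}\lambda|}\le\cot\frac{\pi}{n}.$$ (For $n=1$ one has $K=0$, so there is no nonzero eigenvalue and nothing is claimed.) The bound is sharp for every $n\ge 2$: for each $q>0$, the number $\lambda=-q\,(1-e^{2\pi i/n})$ is a nonzero eigenvalue, with $\operatorname{Re}\lambda\ne 0$, of the matrix $K$ of the simple irreversible cycle $A_1\to A_2\to\cdots\to A_n\to A_1$ with equal rate constants ($q_{j+1,j}=q_{1n}=q$, all other $q_{ij}=0$), and for it $$\frac{|\operatorname{Im}\lambda|}{|\operatorname{Re}\lambda|}=\cot\frac{\pi}{n}.$$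 -/

import Mathlib

/-- The matrix `K` of the master equation
`dp_i/dt = ∑_{j ≠ i} (q i j * p_j - q j i * p_i)` on `n` states, where `q i j` (`i ≠ j`) is the
rate constant of the transition `A_j → A_i`. Diagonal values of `q` are not used. -/
def masterMatrix {n : ℕ} (q : Fin n → Fin n → ℝ) : Matrix (Fin n) (Fin n) ℝ :=
  Matrix.of fun i j =>
    if i = j then -∑ m ∈ Finset.univ.filter (fun m => m ≠ i), q m i else q i j

/-- Rate constants of the simple irreversible cycle `A_1 → A_2 → ⋯ → A_n → A_1` (states are
numbered `0, …, n - 1`), all transitions having rate constant `r`. -/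
def cycleRate (n : ℕ) (r : ℝ) : Fin n → Fin n → ℝ :=
  fun i j => if (i : ℕ) = ((j : ℕ) + 1) % n then r else 0

/-- `z` is a complex eigenvalue of the real square matrix `K`. -/
def IsComplexEigenvalue {n : ℕ} (K : Matrix (Fin n) (Fin n) ℝ) (z : ℂ) : Prop :=
  Module.End.HasEigenvalue (Matrix.toLin' (K.map (fun x : ℝ => (x : ℂ)))) z

open Finset

/-! A left eigenvector turns `z` into a configuration of points `w j` in the plane such that `z * w
j` is a nonnegative combination of the differences `w i - w j`. So wherever a supporting line
touches the configuration, `z * w j` points back into the half plane (`re_neg_of_backward` is the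
maximum modulus version).

Let `z.im > 0` and `arg z = π/2 + b`. If the line with normal direction `φ` touches at a point of
argument `a`, then `t = φ - a`, taken in `(-π/2, π/2)`, is at most `b`. The support function `h`
satisfies `(log h)' = -tan t` away from corners. Over a full turn `log h` returns to its value, so
`log h - φ tan b` drops by `2π tan b`. A single point can account for a drop of at most `2b tan b`,
namely that of `log cos t - t tan b` from `-b` to `b`. Hence `π ≤ n b` (`pi_le_card_mul_of_spiral`),
and `|Im z| / |Re z| = cot b ≤ cot (π/n)`. The powers of `exp (2πi/n)` give equality. -/

/-- A complex number is an eigenvalue of the master equation exactly when the transposed (backward)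
equation has a nonzero solution. -/
lemma isComplexEigenvalue_masterMatrix_iff {n : ℕ} (q : Fin n → Fin n → ℝ) (z : ℂ) :
    IsComplexEigenvalue (masterMatrix q) z ↔
      ∃ w : Fin n → ℂ, w ≠ 0 ∧ ∀ j, ∑ i, (q i j : ℂ) * (w i - w j) = z * w j := by
  set A : Matrix (Fin n) (Fin n) ℂ := (masterMatrix q).map (fun x : ℝ => (x : ℂ)) with hA
  have h1 : IsComplexEigenvalue (masterMatrix q) z ↔ ∃ v ≠ 0, (A - z • 1).mulVec v = 0 := by
    unfold IsComplexEigenvalue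
    rw [← hA]
    constructor
    · intro h
      obtain ⟨v, hv⟩ := h.exists_hasEigenvector
      refine ⟨v, hv.2, ?_⟩
      have := hv.apply_eq_smul
      rw [Matrix.toLin'_apply] at this
      rw [Matrix.sub_mulVec, Matrix.smul_mulVec, Matrix.one_mulVec, this, sub_self]
    · rintro ⟨v, hv0, hv⟩
      refine Module.End.hasEigenvalue_of_hasEigenvector (x := v) ⟨?_, hv0⟩
      rw [Module.End.mem_eigenspace_iff, Matrix.toLin'_apply]
      rwa [Matrix.sub_mulVec, Matrix.smul_mulVec, Matrix.one_mulVec, sub_eq_zero] at hv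
  rw [h1, Matrix.exists_mulVec_eq_zero_iff, ← Matrix.exists_vecMul_eq_zero_iff]
  refine exists_congr fun w => and_congr_right fun _ => ?_
  rw [Matrix.vecMul_sub, Matrix.vecMul_smul, Matrix.vecMul_one, sub_eq_zero, funext_iff]
  refine forall_congr' fun j => ?_
  have : Matrix.vecMul w A j = ∑ i, (q i j : ℂ) * (w i - w j) := by
    have hs : ∀ f : Fin n → ℂ, ∑ i, f i = f j + ∑ i ∈ univ.filter (fun i => i ≠ j), f i := by
      intro f
      rw [← Finset.add_sum_erase _ _ (mem_univ j)]
      congr 1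
      refine Finset.sum_congr ?_ fun _ _ => rfl
      ext; simp
    rw [Matrix.vecMul, dotProduct, hs, hs fun i => (q i j : ℂ) * (w i - w j)]
    have h2 : ∑ i ∈ univ.filter (fun i => i ≠ j), w i * A i j =
        ∑ i ∈ univ.filter (fun i => i ≠ j), w i * (q i j : ℂ) := by
      refine Finset.sum_congr rfl fun i hi => ?_
      have : i ≠ j := by simpa using hi
      simp [hA, masterMatrix, this]
    have h3 : A j j = -∑ i ∈ univ.filter (fun i => i ≠ j), (q i j : ℂ) := by
      simp [hA, masterMatrix]
    rw [h2, h3, sub_self, mul_zero, zero_add]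
    simp only [mul_sub, Finset.sum_sub_distrib, ← Finset.sum_mul]
    rw [Finset.sum_congr rfl fun i _ => mul_comm (w i) (q i j : ℂ)]
    ring
  rw [this]
  rfl

/-- A property that propagates to the right by all sufficiently small steps propagates
indefinitely. -/
lemma forall_ge_of_forall_add {P : ℝ → Prop} {d : ℝ} (hd : 0 < d)
    (h : ∀ φ δ, 0 ≤ δ → δ ≤ d → P φ → P (φ + δ)) {a b : ℝ} (hab : a ≤ b) (ha : P a) : P b := by
  obtain ⟨N, hN⟩ := exists_nat_gt ((b - a) / d)
  have hN0 : (0 : ℝ) < N := lt_of_le_of_lt (div_nonneg (by linarith) hd.le) hN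
  have hδ : (b - a) / N ≤ d := by
    rw [div_le_iff₀ hN0]
    rw [div_lt_iff₀ hd] at hN
    linarith
  have key : ∀ k : ℕ, P (a + k * ((b - a) / N)) := by
    intro k
    induction k with
    | zero => simpa using ha
    | succ k ih =>
      have := h _ _ (div_nonneg (by linarith) hN0.le) hδ ih
      convert this using 1
      push_cast
      ring
  have := key N
  rwa [mul_div_cancel₀ _ hN0.ne', add_sub_cancel] at this

/-! ### The drop that one point can cause -/

/-- The function `log (cos t) - t * tan b`, which has its maximum on `(-π/2, π/2)` at `-b`. -/
noncomputable def logCosSub (b t : ℝ) : ℝ := Real.log (Real.cos t) - t * Real.tan b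

lemma hasDerivAt_logCosSub (b : ℝ) {t : ℝ} (ht : 0 < Real.cos t) :
    HasDerivAt (logCosSub b) (-Real.tan t - Real.tan b) t := by
  have h := ((Real.hasDerivAt_cos t).log ht.ne').sub ((hasDerivAt_id t).mul_const (Real.tan b))
  refine h.congr_deriv ?_
  rw [Real.tan_eq_sin_div_cos t]
  ring

lemma antitoneOn_logCosSub {b : ℝ} (hb : b < Real.pi / 2) :
    AntitoneOn (logCosSub b) (Set.Icc (-b) b) := by
  have hc : ∀ t ∈ Set.Icc (-b) b, 0 < Real.cos t := fun t ht =>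
    Real.cos_pos_of_mem_Ioo ⟨by linarith [ht.1], by linarith [ht.2]⟩
  refine antitoneOn_of_deriv_nonpos (convex_Icc _ _)
    (fun t ht => (hasDerivAt_logCosSub b (hc t ht)).continuousAt.continuousWithinAt)
    (fun t ht => (hasDerivAt_logCosSub b
      (hc t (interior_subset ht))).differentiableAt.differentiableWithinAt) fun t ht => ?_
  rw [(hasDerivAt_logCosSub b (hc t (interior_subset ht))).deriv]
  have ht' := interior_subset ht
  have h1 : Real.tan (-b) ≤ Real.tan t :=
    Real.strictMonoOn_tan.monotoneOn ⟨by linarith, by linarith [ht'.1, ht'.2]⟩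
      ⟨by linarith [ht'.1], by linarith [ht'.2]⟩ ht'.1
  rw [Real.tan_neg] at h1
  linarith

lemma monotoneOn_logCosSub {b : ℝ} (hb0 : 0 < b) (hb : b < Real.pi / 2) :
    MonotoneOn (logCosSub b) (Set.Ioc (-(Real.pi / 2)) (-b)) := by
  have hc : ∀ t ∈ Set.Ioc (-(Real.pi / 2)) (-b), 0 < Real.cos t := fun t ht =>
    Real.cos_pos_of_mem_Ioo ⟨by linarith [ht.1], by linarith [ht.2]⟩
  refine monotoneOn_of_deriv_nonneg (convex_Ioc _ _)
    (fun t ht => (hasDerivAt_logCosSub b (hc t ht)).continuousAt.continuousWithinAt)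
    (fun t ht => (hasDerivAt_logCosSub b
      (hc t (interior_subset ht))).differentiableAt.differentiableWithinAt) fun t ht => ?_
  rw [(hasDerivAt_logCosSub b (hc t (interior_subset ht))).deriv]
  have ht' := interior_subset ht
  have h1 : Real.tan t ≤ Real.tan (-b) :=
    Real.strictMonoOn_tan.monotoneOn ⟨by linarith [ht'.1], by linarith [ht'.2]⟩
      ⟨by linarith, by linarith⟩ ht'.2
  rw [Real.tan_neg] at h1
  linarith

/-- Minus `logCosSub b`, frozen outside `[-b, b]`. -/
noncomputable def clampedNegLogCosSub (b t : ℝ) : ℝ := -logCosSub b (max (-b) (min t b))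

lemma monotone_clampedNegLogCosSub {b : ℝ} (hb0 : 0 < b) (hb : b < Real.pi / 2) :
    Monotone (clampedNegLogCosSub b) := by
  intro t u htu
  have hmem : ∀ s, max (-b) (min s b) ∈ Set.Icc (-b) b := fun s =>
    ⟨le_max_left _ _, max_le (by linarith) (min_le_right _ _)⟩
  exact neg_le_neg (antitoneOn_logCosSub hb (hmem t) (hmem u)
    (max_le_max le_rfl (min_le_min htu le_rfl)))

lemma clampedNegLogCosSub_of_le {b t : ℝ} (hb0 : 0 < b) (ht : t ≤ -b) :
    clampedNegLogCosSub b t = -logCosSub b (-b) := by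
  rw [clampedNegLogCosSub, min_eq_left (by linarith), max_eq_left ht]

lemma clampedNegLogCosSub_of_ge {b t : ℝ} (hb0 : 0 < b) (ht : b ≤ t) :
    clampedNegLogCosSub b t = -logCosSub b b := by
  rw [clampedNegLogCosSub, min_eq_right ht, max_eq_right (by linarith)]

lemma clampedNegLogCosSub_of_mem {b t : ℝ} (h1 : -b ≤ t) (h2 : t ≤ b) :
    clampedNegLogCosSub b t = -logCosSub b t := by
  rw [clampedNegLogCosSub, min_eq_left h2, max_eq_right h1]

/-- On `[-b, b]` the clamp cancels the fall of `logCosSub` exactly; left of `-b` the clamp is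
constant and `logCosSub` itself rises. -/
lemma logCosSub_add_clamped_le {b t u : ℝ} (hb0 : 0 < b) (hb : b < Real.pi / 2)
    (ht : -(Real.pi / 2) < t) (htu : t ≤ u) (hu : u ≤ b) :
    logCosSub b t + clampedNegLogCosSub b t ≤ logCosSub b u + clampedNegLogCosSub b u := by
  rcases le_total t (-b) with h | h
  · rw [clampedNegLogCosSub_of_le hb0 h]
    rcases le_total u (-b) with h' | h'
    · rw [clampedNegLogCosSub_of_le hb0 h']
      linarith [monotoneOn_logCosSub hb0 hb ⟨ht, h⟩ ⟨by linarith, h'⟩ htu]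
    · rw [clampedNegLogCosSub_of_mem h' hu]
      linarith [monotoneOn_logCosSub hb0 hb ⟨ht, h⟩ ⟨by linarith, le_rfl⟩ h]
  · rw [clampedNegLogCosSub_of_mem h (htu.trans hu),
      clampedNegLogCosSub_of_mem (h.trans htu) hu]
    linarith

lemma exists_sub_mem_of_cos_pos {t : ℝ} (h1 : -Real.pi ≤ t) (h2 : t ≤ 3 * Real.pi)
    (hc : 0 < Real.cos t) :
    (-(Real.pi / 2) < t ∧ t < Real.pi / 2) ∨
      (-(Real.pi / 2) < t - 2 * Real.pi ∧ t - 2 * Real.pi < Real.pi / 2) := by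
  have hpi := Real.pi_pos
  by_contra! hcon
  obtain ⟨ha, hb⟩ := hcon
  refine absurd hc (not_lt.2 ?_)
  rcases le_or_gt t (-(Real.pi / 2)) with h | h
  · rw [← Real.cos_neg]
    exact Real.cos_nonpos_of_pi_div_two_le_of_le (by linarith) (by linarith)
  · have h3 := ha h
    rcases le_or_gt (t - 2 * Real.pi) (-(Real.pi / 2)) with h' | h'
    · exact Real.cos_nonpos_of_pi_div_two_le_of_le h3 (by linarith)
    · rw [← Real.cos_sub_two_pi]
      exact Real.cos_nonpos_of_pi_div_two_le_of_le (hb h') (by linarith)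

/-! ### Counting points by one turn of the supporting line -/

/-- Consider points with polar coordinates `(r i, a i)`. If at every point that is extremal in the
direction `φ` the spiral field with angle `b` points into the supporting half plane, then the
number of points is at least `π / b`. -/
theorem pi_le_card_mul_of_spiral {ι : Type*} [Fintype ι] {r a : ι → ℝ} {b : ℝ}
    (hb0 : 0 < b) (hb : b < Real.pi / 2) (hr : ∀ i, 0 ≤ r i) (hr0 : ∃ i, r i ≠ 0)
    (ha : ∀ i, -Real.pi < a i ∧ a i ≤ Real.pi)
    (hsp : ∀ φ i, (∀ j, r j * Real.cos (φ - a j) ≤ r i * Real.cos (φ - a i)) →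
      0 ≤ r i * Real.sin (b - (φ - a i))) :
    Real.pi ≤ Fintype.card ι * b := by
  have hpi := Real.pi_pos
  have hne : Nonempty ι := ⟨hr0.choose⟩
  have hmax : ∀ φ, ∃ i, ∀ j, r j * Real.cos (φ - a j) ≤ r i * Real.cos (φ - a i) := fun φ =>
    Finite.exists_max fun i => r i * Real.cos (φ - a i)
  -- the support function is positive
  have hpos : ∀ φ, ∃ i, 0 < r i * Real.cos (φ - a i) := by
    -- The touching point has angle at most `b`, so so small a rotation keeps its cosine positive.
    have hstep : ∀ φ δ, 0 ≤ δ → δ ≤ (Real.pi / 2 - b) / 2 →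
        (∃ i, 0 < r i * Real.cos (φ - a i)) → ∃ i, 0 < r i * Real.cos (φ + δ - a i) := by
      rintro φ δ hδ0 hδ ⟨j, hj⟩
      obtain ⟨i, hi⟩ := hmax φ
      have hp := hj.trans_le (hi j)
      have hri : 0 < r i := (hr i).lt_of_ne' fun h => by simp [h] at hp
      have hc : 0 < Real.cos (φ - a i) := pos_of_mul_pos_right hp (hr i)
      have hs : 0 ≤ Real.sin (b - (φ - a i)) := nonneg_of_mul_nonneg_right (hsp φ i hi) hri
      refine ⟨i, mul_pos hri ?_⟩
      have hcb : 0 < Real.cos b := Real.cos_pos_of_mem_Ioo ⟨by linarith, hb⟩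
      have hcbd : 0 < Real.cos (b + δ) :=
        Real.cos_pos_of_mem_Ioo ⟨by linarith, by linarith⟩
      have hsd : 0 ≤ Real.sin δ := Real.sin_nonneg_of_nonneg_of_le_pi hδ0 (by linarith)
      have hid : Real.cos (φ - a i + δ) * Real.cos b =
          Real.cos (φ - a i) * Real.cos (b + δ) + Real.sin δ * Real.sin (b - (φ - a i)) := by
        rw [Real.cos_add, Real.cos_add, Real.sin_sub b]
        ring
      have : 0 < Real.cos (φ - a i + δ) * Real.cos b := by
        rw [hid]
        positivity
      rw [show φ + δ - a i = φ - a i + δ by ring]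
      exact pos_of_mul_pos_left this hcb.le
    intro φ
    obtain ⟨i, hi⟩ := hr0
    -- Propagation only goes to the right: start in the direction of a nonzero point and reach `φ`
    -- modulo `2π`.
    obtain ⟨k, hk⟩ := exists_nat_ge ((a i - φ) / (2 * Real.pi))
    rw [div_le_iff₀ (by linarith)] at hk
    obtain ⟨j, hj⟩ := forall_ge_of_forall_add (P := fun φ => ∃ i, 0 < r i * Real.cos (φ - a i))
      (by linarith) hstep (show a i ≤ φ + k * (2 * Real.pi) by linarith)
      ⟨i, by simpa using (hr i).lt_of_ne' hi⟩
    refine ⟨j, ?_⟩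
    rwa [add_sub_right_comm, Real.cos_add_nat_mul_two_pi] at hj
  by_contra! hlt
  have hn : (0 : ℝ) < Fintype.card ι := by exact_mod_cast Fintype.card_pos
  -- a slightly larger angle, which makes the comparison steps uniform
  obtain ⟨b', hbb', hb'⟩ : ∃ b', b < b' ∧ b' < min (Real.pi / 2) (Real.pi / Fintype.card ι) :=
    exists_between (lt_min hb (by rw [lt_div_iff₀ hn]; linarith))
  obtain ⟨hb'2, hb'n⟩ := lt_min_iff.1 hb'
  rw [lt_div_iff₀ hn] at hb'n
  have hb'0 : 0 < b' := hb0.trans hbb'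
  set g := clampedNegLogCosSub b' with hg
  have hgm : Monotone g := monotone_clampedNegLogCosSub hb'0 hb'2
  set h : ℝ → ℝ := fun φ => univ.sup' univ_nonempty fun i => r i * Real.cos (φ - a i) with hh
  have hle : ∀ φ i, r i * Real.cos (φ - a i) ≤ h φ := fun φ i =>
    Finset.le_sup' (fun i => r i * Real.cos (φ - a i)) (mem_univ i)
  have hattain : ∀ φ, ∃ i, h φ = r i * Real.cos (φ - a i) := fun φ => by
    obtain ⟨i, -, hi⟩ := Finset.exists_mem_eq_sup' (univ_nonempty (α := ι))
      fun i => r i * Real.cos (φ - a i)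
    exact ⟨i, hi⟩
  -- For `φ` in `[0, 2π]` the angle `φ - a i` lies in `[-π, 3π)`, so it can meet the window around
  -- `0` or the one around `2π`; hence two clamps per point.
  set U : ℝ → ℝ := fun φ => Real.log (h φ) - φ * Real.tan b' +
    ∑ i, (g (φ - a i) + g (φ - a i - 2 * Real.pi)) with hU
  have hstep : ∀ φ δ, 0 ≤ φ → φ ≤ 2 * Real.pi → 0 ≤ δ → δ ≤ b' - b → U φ ≤ U (φ + δ) := by
    intro φ δ hφ0 hφ1 hδ0 hδ
    obtain ⟨i, hi⟩ := hattain φ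
    have himax : ∀ j, r j * Real.cos (φ - a j) ≤ r i * Real.cos (φ - a i) := fun j =>
      hi ▸ hle φ j
    obtain ⟨j, hj⟩ := hpos φ
    have hp := hj.trans_le (himax j)
    have hri : 0 < r i := (hr i).lt_of_ne' fun h => by simp [h] at hp
    have hc : 0 < Real.cos (φ - a i) := pos_of_mul_pos_right hp (hr i)
    have hs : 0 ≤ Real.sin (b - (φ - a i)) := nonneg_of_mul_nonneg_right (hsp φ i himax) hri
    have main : ∀ t, Real.cos t = Real.cos (φ - a i) →
        Real.cos (t + δ) = Real.cos (φ + δ - a i) → Real.sin (b - t) = Real.sin (b - (φ - a i)) →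
        -(Real.pi / 2) < t → t < Real.pi / 2 →
        Real.log (h φ) - φ * Real.tan b' + g t ≤
          Real.log (h (φ + δ)) - (φ + δ) * Real.tan b' + g (t + δ) := by
      intro t hct hctd hst ht1 ht2
      have htb : t ≤ b := by
        by_contra! hcon
        have : Real.sin (b - t) < 0 := Real.sin_neg_of_neg_of_neg_pi_lt (by linarith)
          (by linarith)
        linarith
      have hcos : 0 < Real.cos (t + δ) :=
        Real.cos_pos_of_mem_Ioo ⟨by linarith, by linarith⟩
      have h1 := logCosSub_add_clamped_le hb'0 hb'2 ht1 (le_add_of_nonneg_right hδ0)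
        (show t + δ ≤ b' by linarith)
      have h2 : Real.log (r i) + Real.log (Real.cos (t + δ)) ≤ Real.log (h (φ + δ)) := by
        rw [← Real.log_mul hri.ne' hcos.ne']
        refine Real.log_le_log (mul_pos hri hcos) ?_
        rw [hctd]
        exact hle _ i
      have h3 : Real.log (h φ) = Real.log (r i) + Real.log (Real.cos t) := by
        rw [hi, hct, Real.log_mul hri.ne' hc.ne']
      simp only [logCosSub] at h1
      rw [h3]
      linarith
    -- The clamps of the other points only increase, so the touching point alone gives a lower
    -- bound.
    have hsum : ∀ c, c ≤ (g (φ + δ - a i) + g (φ + δ - a i - 2 * Real.pi)) -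
          (g (φ - a i) + g (φ - a i - 2 * Real.pi)) →
        c ≤ ∑ i, (g (φ + δ - a i) + g (φ + δ - a i - 2 * Real.pi)) -
          ∑ i, (g (φ - a i) + g (φ - a i - 2 * Real.pi)) := by
      intro c hcle
      rw [← Finset.sum_sub_distrib]
      refine hcle.trans (Finset.single_le_sum (f := fun i =>
        (g (φ + δ - a i) + g (φ + δ - a i - 2 * Real.pi)) -
          (g (φ - a i) + g (φ - a i - 2 * Real.pi))) (fun k _ => ?_) (mem_univ i))
      exact sub_nonneg.2 (add_le_add (hgm (by linarith)) (hgm (by linarith)))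
    have m1 : g (φ - a i) ≤ g (φ + δ - a i) := hgm (by linarith)
    have m2 : g (φ - a i - 2 * Real.pi) ≤ g (φ + δ - a i - 2 * Real.pi) := hgm (by linarith)
    simp only [hU]
    rcases exists_sub_mem_of_cos_pos (by linarith [(ha i).2]) (by linarith [(ha i).1]) hc with
      ⟨ht1, ht2⟩ | ⟨ht1, ht2⟩
    · have := main _ rfl (by congr 1; ring) rfl ht1 ht2
      rw [show φ - a i + δ = φ + δ - a i by ring] at this
      linarith [hsum (g (φ + δ - a i) - g (φ - a i)) (by linarith)]
    · have := main _ (Real.cos_sub_two_pi _)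
        (by rw [← Real.cos_sub_two_pi (φ + δ - a i)]; congr 1; ring)
        (by rw [← Real.sin_add_two_pi (b - (φ - a i))]; congr 1; ring) ht1 ht2
      rw [show φ - a i - 2 * Real.pi + δ = φ + δ - a i - 2 * Real.pi by ring] at this
      linarith [hsum (g (φ + δ - a i - 2 * Real.pi) - g (φ - a i - 2 * Real.pi)) (by linarith)]
  have hmono : U 0 ≤ U (2 * Real.pi) := by
    refine (forall_ge_of_forall_add (P := fun φ => 0 ≤ φ ∧ (φ ≤ 2 * Real.pi → U 0 ≤ U φ))
      (d := b' - b) (by linarith) ?_ (by linarith : (0 : ℝ) ≤ 2 * Real.pi)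
      ⟨le_rfl, fun _ => le_rfl⟩).2 le_rfl
    rintro φ δ hδ0 hδ ⟨h0, h1⟩
    exact ⟨by linarith, fun h2 => (h1 (by linarith)).trans
      (hstep φ δ h0 (by linarith) hδ0 hδ)⟩
  have hper : h (2 * Real.pi) = h 0 := by
    simp only [hh]
    congr 1
    ext i
    rw [show 2 * Real.pi - a i = 0 - a i + 2 * Real.pi by ring, Real.cos_add_two_pi]
  -- The two middle clamps coincide and cancel; the outer two are frozen at opposite ends of the
  -- window.
  have hgsum : ∑ i, (g (2 * Real.pi - a i) + g (2 * Real.pi - a i - 2 * Real.pi)) -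
      ∑ i, (g (0 - a i) + g (0 - a i - 2 * Real.pi)) =
        Fintype.card ι * (2 * b' * Real.tan b') := by
    rw [← Finset.sum_sub_distrib, Finset.sum_congr rfl (g := fun _ => 2 * b' * Real.tan b')]
    · simp
    · intro i _
      rw [show 2 * Real.pi - a i - 2 * Real.pi = 0 - a i by ring, hg,
        clampedNegLogCosSub_of_ge (t := 2 * Real.pi - a i) hb'0 (by linarith [(ha i).2]),
        clampedNegLogCosSub_of_le (t := 0 - a i - 2 * Real.pi) hb'0 (by linarith [(ha i).1])]
      simp only [logCosSub, Real.cos_neg]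
      ring
  have htan : 0 < Real.tan b' := Real.tan_pos_of_pos_of_lt_pi_div_two hb'0 hb'2
  simp only [hU, hper] at hmono
  nlinarith

/-! ### Location of the eigenvalues -/

/-- A nonzero number for which the backward equation has a nonzero solution has negative real
part. -/
lemma re_neg_of_backward {ι : Type*} [Fintype ι] {q : ι → ι → ℝ}
    (hq : ∀ i j, i ≠ j → 0 ≤ q i j) {z : ℂ} (hz : z ≠ 0) {w : ι → ℂ} (hw0 : w ≠ 0)
    (hw : ∀ j, ∑ i, (q i j : ℂ) * (w i - w j) = z * w j) : z.re < 0 := by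
  obtain ⟨k, hk⟩ := Function.ne_iff.1 hw0
  have : Nonempty ι := ⟨k⟩
  obtain ⟨j, hj⟩ := Finite.exists_max fun i => ‖w i‖
  have hwj : 0 < ‖w j‖ := (norm_pos_iff.2 hk).trans_le (hj k)
  have hre : ∀ i, (w i * starRingEnd ℂ (w j)).re ≤ ‖w j‖ ^ 2 := fun i => by
    refine (Complex.re_le_norm _).trans ?_
    rw [norm_mul, Complex.norm_conj, sq]
    exact mul_le_mul_of_nonneg_right (hj i) (norm_nonneg _)
  have hsum : ∑ i, q i j * ((w i * starRingEnd ℂ (w j)).re - ‖w j‖ ^ 2) =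
      z.re * ‖w j‖ ^ 2 := by
    have h1 := congrArg (fun u => (u * starRingEnd ℂ (w j)).re) (hw j)
    simp only [Finset.sum_mul, Complex.re_sum, mul_assoc, sub_mul, Complex.mul_conj,
      Complex.re_ofReal_mul, Complex.re_mul_ofReal, Complex.sub_re, Complex.ofReal_re,
      Complex.normSq_eq_norm_sq] at h1
    exact h1
  have hterm : ∀ i ∈ univ, q i j * ((w i * starRingEnd ℂ (w j)).re - ‖w j‖ ^ 2) ≤ 0 := by
    intro i _
    rcases eq_or_ne i j with rfl | hij
    · rw [Complex.mul_conj, Complex.ofReal_re, Complex.normSq_eq_norm_sq, sub_self, mul_zero]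
    · exact mul_nonpos_of_nonneg_of_nonpos (hq i j hij) (sub_nonpos.2 (hre i))
  have hle : z.re ≤ 0 := by
    have h2 := Finset.sum_nonpos hterm
    rw [hsum] at h2
    exact nonpos_of_mul_nonpos_left h2 (by positivity)
  refine hle.lt_of_ne fun h0 => hz ?_
  have hz0 := (Finset.sum_eq_zero_iff_of_nonpos hterm).1 (by rw [hsum, h0, zero_mul])
  -- If the real part vanishes, every `w i` with nonzero rate from `j` equals `w j`: the equality
  -- case of Cauchy–Schwarz.
  have hall : ∑ i, (q i j : ℂ) * (w i - w j) = 0 := by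
    refine Finset.sum_eq_zero fun i hi => ?_
    rcases mul_eq_zero.1 (hz0 i hi) with h | h
    · simp [h]
    · have hd : Complex.normSq (w i - w j) ≤ 0 := by
        rw [Complex.normSq_sub, Complex.normSq_eq_norm_sq, Complex.normSq_eq_norm_sq]
        have := pow_le_pow_left₀ (norm_nonneg _) (hj i) 2
        linarith
      rw [Complex.normSq_eq_zero.1 (le_antisymm hd (Complex.normSq_nonneg _)), mul_zero]
  rw [hw j] at hall
  exact (mul_eq_zero.1 hall).resolve_right (norm_pos_iff.1 hwj)

lemma norm_mul_cos_sub_arg (x : ℂ) (φ : ℝ) :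
    ‖x‖ * Real.cos (φ - x.arg) = (x * Complex.exp (-φ * Complex.I)).re := by
  rw [← Complex.ofReal_neg, Complex.mul_re, Complex.exp_ofReal_mul_I_re,
    Complex.exp_ofReal_mul_I_im, Real.cos_neg, Real.sin_neg, Real.cos_sub]
  linear_combination Real.cos φ * Complex.norm_mul_cos_arg x +
    Real.sin φ * Complex.norm_mul_sin_arg x

/-- With `arg z = b + π/2`, the inward condition on `z * w j` is exactly the spiral hypothesis, and
`cot` decreases from `π/n` to `b`. -/
lemma im_div_re_le_cot_of_im_pos {n : ℕ} {q : Fin n → Fin n → ℝ}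
    (hq : ∀ i j, i ≠ j → 0 ≤ q i j) {z : ℂ} (hre : z.re < 0) (him : 0 < z.im) {w : Fin n → ℂ}
    (hw0 : w ≠ 0) (hw : ∀ j, ∑ i, (q i j : ℂ) * (w i - w j) = z * w j) :
    |z.im| / |z.re| ≤ Real.cot (Real.pi / n) := by
  have hpi := Real.pi_pos
  have hz0 : z ≠ 0 := fun h => by simp [h] at him
  have hzn : 0 < ‖z‖ := norm_pos_iff.2 hz0
  obtain ⟨b, hb⟩ : ∃ b, b = z.arg - Real.pi / 2 := ⟨_, rfl⟩
  have hzarg : z.arg = b + Real.pi / 2 := by rw [hb]; ring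
  have hzre : z.re = -(‖z‖ * Real.sin b) := by
    rw [← Complex.norm_mul_cos_arg, hzarg, Real.cos_add_pi_div_two]; ring
  have hzim : z.im = ‖z‖ * Real.cos b := by
    rw [← Complex.norm_mul_sin_arg, hzarg, Real.sin_add_pi_div_two]
  have hsin : 0 < Real.sin b := by
    refine pos_of_mul_pos_right (a := ‖z‖) ?_ hzn.le; linarith
  have hcos : 0 < Real.cos b := by
    refine pos_of_mul_pos_right (a := ‖z‖) ?_ hzn.le; linarith
  have hargpos : 0 ≤ z.arg := Complex.arg_nonneg_iff.2 him.le
  have hargle := Complex.arg_le_pi z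
  have hb0 : 0 < b := by
    by_contra! h
    linarith [Real.sin_nonpos_of_nonpos_of_neg_pi_le h (by linarith)]
  have hb2 : b < Real.pi / 2 := by
    refine lt_of_le_of_ne (by linarith) fun h => ?_
    rw [h, Real.cos_pi_div_two] at hcos
    exact lt_irrefl _ hcos
  have key : Real.pi ≤ Fintype.card (Fin n) * b := by
    refine pi_le_card_mul_of_spiral (r := fun i => ‖w i‖) (a := fun i => (w i).arg) hb0 hb2
      (fun _ => norm_nonneg _) ?_ (fun i => ⟨Complex.neg_pi_lt_arg _, Complex.arg_le_pi _⟩) ?_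
    · obtain ⟨k, hk⟩ := Function.ne_iff.1 hw0
      exact ⟨k, norm_ne_zero_iff.2 hk⟩
    · intro φ j hj
      simp only [norm_mul_cos_sub_arg] at hj
      have h1 : (z * w j * Complex.exp (-φ * Complex.I)).re ≤ 0 := by
        rw [← hw j, Finset.sum_mul, Complex.re_sum]
        refine Finset.sum_nonpos fun i _ => ?_
        rw [mul_assoc, Complex.re_ofReal_mul, sub_mul, Complex.sub_re]
        rcases eq_or_ne i j with rfl | hij
        · simp
        · exact mul_nonpos_of_nonneg_of_nonpos (hq i j hij) (sub_nonpos.2 (hj i))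
      have h2 : (z * w j * Complex.exp (-φ * Complex.I)).re =
          -(‖z‖ * (‖w j‖ * Real.sin (b - (φ - (w j).arg)))) := by
        have h3 : (w j * Complex.exp (-φ * Complex.I)).im =
            -(‖w j‖ * Real.sin (φ - (w j).arg)) := by
          have := norm_mul_cos_sub_arg (w j) (φ + Real.pi / 2)
          rw [add_sub_right_comm, Real.cos_add_pi_div_two] at this
          rw [← mul_neg, this, Complex.ofReal_add, neg_add, add_mul, Complex.exp_add, ← mul_assoc]
          have : Complex.exp (-((Real.pi / 2 : ℝ) : ℂ) * Complex.I) = -Complex.I := by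
            push_cast
            rw [← neg_div, Complex.exp_neg_pi_div_two_mul_I]
          rw [this]
          simp
        rw [mul_assoc, Complex.mul_re, h3, ← norm_mul_cos_sub_arg, hzre, hzim, Real.sin_sub b]
        ring
      rw [h2] at h1
      exact nonneg_of_mul_nonneg_right (by linarith) hzn
  rw [Fintype.card_fin] at key
  have hn : (0 : ℝ) < n := by
    by_contra! h
    nlinarith
  have hc0 : 0 < Real.pi / n := by positivity
  have hcb : Real.pi / n ≤ b := by rw [div_le_iff₀ hn]; linarith
  have hsc : 0 < Real.sin (Real.pi / n) := Real.sin_pos_of_pos_of_lt_pi hc0 (by linarith)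
  rw [abs_of_pos him, abs_of_neg hre, hzre, hzim, neg_neg, mul_div_mul_left _ _ hzn.ne',
    Real.cot_eq_cos_div_sin, div_le_div_iff₀ hsin hsc]
  have := Real.sin_nonneg_of_nonneg_of_le_pi (sub_nonneg.2 hcb) (by linarith)
  rw [Real.sin_sub] at this
  linarith

lemma cot_pi_div_nat_nonneg (n : ℕ) : 0 ≤ Real.cot (Real.pi / n) := by
  have hpi := Real.pi_pos
  rcases Nat.lt_or_ge n 2 with h | h
  -- Division by zero makes both values `0`: `π / 0 = 0`, and `sin` vanishes at `0` and `π`.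
  · interval_cases n <;> simp [Real.cot_eq_cos_div_sin]
  · have h2 : (2 : ℝ) ≤ n := by exact_mod_cast h
    have hle : Real.pi / n ≤ Real.pi / 2 := by gcongr
    have h0 : 0 < Real.pi / n := by positivity
    rw [Real.cot_eq_cos_div_sin]
    exact div_nonneg (Real.cos_nonneg_of_neg_pi_div_two_le_of_le (by linarith) hle)
      (Real.sin_nonneg_of_nonneg_of_le_pi h0.le (by linarith))

/-! ### Sharpness: the irreversible cycle -/

lemma isComplexEigenvalue_cycle {n : ℕ} (hn : 2 ≤ n) (r : ℝ) :
    IsComplexEigenvalue (masterMatrix (cycleRate n r))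
      (-(r : ℂ) * (1 - Complex.exp (2 * Real.pi * Complex.I / n))) := by
  have hn0 : n ≠ 0 := by omega
  set ω := Complex.exp (2 * Real.pi * Complex.I / n) with hω
  have hpow : ω ^ n = 1 := (Complex.isPrimitiveRoot_exp n hn0).pow_eq_one
  rw [isComplexEigenvalue_masterMatrix_iff]
  refine ⟨fun j => ω ^ (j : ℕ), ?_, fun j => ?_⟩
  · exact Function.ne_iff.2 ⟨⟨0, by omega⟩, by simp⟩
  · have hlt : ((j : ℕ) + 1) % n < n := Nat.mod_lt _ (by omega)
    rw [Finset.sum_eq_single ⟨((j : ℕ) + 1) % n, hlt⟩]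
    · simp only [cycleRate, if_true]
      rw [← pow_eq_pow_mod _ hpow]
      ring
    · intro i _ hi
      have : ¬ (i : ℕ) = ((j : ℕ) + 1) % n := fun h => hi (Fin.ext h)
      simp [cycleRate, this]
    · simp

lemma cycle_eigenvalue_ratio {n : ℕ} (hn : 2 ≤ n) {r : ℝ} (hr : 0 < r) {z : ℂ}
    (hz : z = -(r : ℂ) * (1 - Complex.exp (2 * Real.pi * Complex.I / n))) :
    z.re ≠ 0 ∧ |z.im| / |z.re| = Real.cot (Real.pi / n) := by
  have hpi := Real.pi_pos
  have h2 : (2 : ℝ) ≤ n := by exact_mod_cast hn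
  set c := Real.pi / n with hc
  have hle : c ≤ Real.pi / 2 := by rw [hc]; gcongr
  have h0 : 0 < c := by positivity
  have hsin : 0 < Real.sin c := Real.sin_pos_of_pos_of_lt_pi h0 (by linarith)
  have hcos : 0 ≤ Real.cos c := Real.cos_nonneg_of_neg_pi_div_two_le_of_le (by linarith) hle
  have hexp : Complex.exp (2 * Real.pi * Complex.I / n) =
      Complex.exp ((2 * c : ℝ) * Complex.I) := by
    congr 1
    rw [hc]
    push_cast
    ring
  rw [hexp, ← Complex.ofReal_neg] at hz
  have hre : z.re = -(2 * r * Real.sin c ^ 2) := by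
    rw [hz, Complex.re_ofReal_mul, Complex.sub_re, Complex.one_re, Complex.exp_ofReal_mul_I_re,
      Real.cos_two_mul, Real.cos_sq']
    ring
  have him : z.im = 2 * r * Real.sin c * Real.cos c := by
    rw [hz, Complex.im_ofReal_mul, Complex.sub_im, Complex.one_im, Complex.exp_ofReal_mul_I_im,
      Real.sin_two_mul]
    ring
  have hpos : 0 < 2 * r * Real.sin c ^ 2 := by positivity
  refine ⟨by rw [hre]; linarith, ?_⟩
  rw [hre, him, abs_neg, abs_of_pos hpos, abs_of_nonneg (by positivity),
    Real.cot_eq_cos_div_sin]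
  field_simp

theorem mainTheorem1 (n : ℕ) :
    (∀ q : Fin n → Fin n → ℝ, (∀ i j, i ≠ j → 0 ≤ q i j) →
      ∀ z : ℂ, IsComplexEigenvalue (masterMatrix q) z → z ≠ 0 →
        z.re ≠ 0 ∧ |z.im| / |z.re| ≤ Real.cot (Real.pi / n)) ∧
    (2 ≤ n → ∀ r : ℝ, 0 < r → ∀ z : ℂ,
      z = -(r : ℂ) * (1 - Complex.exp (2 * Real.pi * Complex.I / n)) →
        IsComplexEigenvalue (masterMatrix (cycleRate n r)) z ∧ z ≠ 0 ∧
        z.re ≠ 0 ∧ |z.im| / |z.re| = Real.cot (Real.pi / n)) := by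
  constructor
  · intro q hq z hz hz0
    obtain ⟨w, hw0, hw⟩ := (isComplexEigenvalue_masterMatrix_iff q z).1 hz
    have hre := re_neg_of_backward hq hz0 hw0 hw
    refine ⟨hre.ne, ?_⟩
    rcases lt_trichotomy z.im 0 with him | him | him
    -- The rates are real, so conjugation reduces to positive imaginary part.
    · have hconj : ∀ j, ∑ i, (q i j : ℂ) * (starRingEnd ℂ (w i) - starRingEnd ℂ (w j)) =
          starRingEnd ℂ z * starRingEnd ℂ (w j) := fun j => by
        rw [← map_mul, ← hw j, map_sum]
        simp
      have := im_div_re_le_cot_of_im_pos hq (z := starRingEnd ℂ z)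
        (w := fun i => starRingEnd ℂ (w i)) (by simpa using hre) (by simpa using him) ?_ hconj
      · simpa using this
      · obtain ⟨k, hk⟩ := Function.ne_iff.1 hw0
        exact Function.ne_iff.2 ⟨k, by simpa using hk⟩
    · rw [him, abs_zero, zero_div]
      exact cot_pi_div_nat_nonneg n
    · exact im_div_re_le_cot_of_im_pos hq hre him hw0 hw
  · intro hn r hr z hz
    obtain ⟨hre, hratio⟩ := cycle_eigenvalue_ratio hn hr hz
    exact ⟨hz ▸ isComplexEigenvalue_cycle hn r, fun h => hre (by simp [h]), hre, hratio⟩
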